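/- A (finite) Markov decision process consists of a finite state space $S$, a finite non-empty action set $A(s)$ for every $s\in S$, a payoff function $r(s,a)\in\mathbb{R}$ and a transition function $q(\cdot\mid s,a)\in\Delta(S)$, where $\Delta(S)$ is the set of probability distributions on $S$. For a prior $\mu\in\Delta(S)$, a behavior strategy $\sigma$ (which assigns to every finite history $(s_1,a_1,\dots,s_n)$ a probability distribution on $A(s_n)$) and $\lambda\in[0,1)$, put $\gamma_\lambda(\mu,\sigma)=\mathbb{E}_{\mu,\sigma}\bigl[\sum_{n\ge 1}\lambda^{n-1}r(s_n,a_n)\bigr]$ and $v_\lambda(\mu)=\sup_\sigma\gamma_\lambda(\mu,\sigma)$, the supremum being over all behavior strategies; write $\gamma_\lambda(s,\sigma)$ when $\mu$ is concentrated on the state $s$. Let $\mathcal{F}$ be the set of functions on $[0,1)$ of the form $P/D$, with $P,D$ real polynomials and $D\neq 0$, such that every complex root of $D$ either has modulus $>1$ or is a root of unity and a simple root of $D$. Let $\mathrm{Max}\mathcal{F}$ be the set of pointwise maxima of finitely many (at least one) functions in $\mathcal{F}$. 1. For every Markov decision process and every prior $\mu$, the value function $\lambda\mapsto v_\lambda(\mu)$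 on $[0,1)$ belongs to $\mathrm{Max}\mathcal{F}$. 2. Let $\sigma$ be a pure stationary strategy, i.e. $\sigma(s)\in A(s)$ for $s\in S$, let $Q=(q(s'\mid s,\sigma(s)))_{s,s'\in S}$ be its transition matrix and $r=(r(s,\sigma(s)))_{s\in S}$ its vector of stage payoffs. For every $\lambda\in[0,1)$ the matrix $I-\lambda Q$ is invertible and $(\gamma_\lambda(s,\sigma))_{s\in S}=(I-\lambda Q)^{-1}r$. The polynomial $\det(I-\lambda Q)$ in $\lambda$ has no complex root in the open unit ball, and each of its roots on the unit circle is a root of unity. For every prior $\mu$, the function $\lambda\mapsto\gamma_\lambda(\mu,\sigma)$ on $[0,1)$ can be written as $P/D$ with $P,D$ coprime real polynomials such that $D$ divides $\det(I-\lambda Q)$, $D$ has no roots in the open unit ball, and all roots of $D$ on the unit circle are roots of unity and simple roots of $D$; in particular it belongs to $\mathcal{F}$. -/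

import Mathlib

open MeasureTheory ProbabilityTheory Polynomial

universe u v

/-- A Markov decision process with state space `S` and action sets `A s`: a payoff function `r`
and a transition function `q`. The finiteness of `S` and of the `A s` and the non-emptiness of the
`A s` are imposed where they are needed; the prior over the initial state is a separate argument. -/
structure MDP (S : Type u) (A : S → Type v) where
  /-- the payoff function -/
  r : (s : S) → A s → ℝ
  /-- the transition function -/
  q : (s : S) → A s → PMF S

namespace MDP

/-- The set `SA` of pairs of a state and an action available at it. -/
def SA {S : Type u} (A : S → Type v) : Type (max u v) := Σ s : S, A s

instance {S : Type u} (A : S → Type v) [Finite S] [∀ s, Finite (A s)] : Finite (SA A) :=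
  inferInstanceAs (Finite (Σ s : S, A s))

/-- `SA` carries the discrete σ-algebra. -/
instance {S : Type u} (A : S → Type v) : MeasurableSpace (SA A) := ⊤

/-- A behavior strategy: to every finite history `(s₁, a₁, …, sₖ, aₖ, s)`, given by the first `k`
state-action pairs and the current state `s`, it assigns a distribution over `A s`. -/
abbrev BehaviorStrategy {S : Type u} (A : S → Type v) : Type (max u v) :=
  (k : ℕ) → (Fin k → SA A) → (s : S) → PMF (A s)

/-- A pure stationary strategy: a choice of an available action in every state. -/
abbrev PureStationary {S : Type u} (A : S → Type v) : Type (max u v) := (s : S) → A s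

/-- A pure stationary strategy as a behavior strategy. -/
noncomputable def PureStationary.toBehavior {S : Type u} {A : S → Type v} (σ : PureStationary A) :
    BehaviorStrategy A :=
  fun _ _ s => PMF.pure (σ s)

/-- The law of the current state-action pair, if the current state has law `p` and the action is
then chosen according to the mixed actions `α`. -/
noncomputable def stageLaw {S : Type u} {A : S → Type v} (p : PMF S) (α : (s : S) → PMF (A s)) :
    PMF (SA A) :=
  p.bind fun s => (α s).map fun a => (⟨s, a⟩ : SA A)

section process

variable {S : Type u} {A : S → Type v} [Finite S] [∀ s, Finite (A s)]

/-- The law of the pair of stage `n + 1` given the pairs `h 0, …, h n` of the stages `0, …, n`: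
the new state is drawn from `q` at the last pair, then the action from the strategy. -/
noncomputable def stepKernel (M : MDP S A) (σ : BehaviorStrategy A) (n : ℕ) :
    Kernel (Finset.Iic n → SA A) (SA A) :=
  Kernel.ofFunOfCountable fun h =>
    (stageLaw
      (M.q (h ⟨n, Finset.mem_Iic.2 le_rfl⟩).1 (h ⟨n, Finset.mem_Iic.2 le_rfl⟩).2)
      (σ (n + 1) fun i => h ⟨i, Finset.mem_Iic.2 (Nat.lt_succ_iff.1 i.2)⟩)).toMeasure

instance (M : MDP S A) (σ : BehaviorStrategy A) (n : ℕ) : IsMarkovKernel (M.stepKernel σ n) :=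
  ⟨fun _ => PMF.toMeasure.isProbabilityMeasure _⟩

/-- The probability distribution over infinite histories `(SA)^∞` induced by the prior `μ` and the
behavior strategy `σ`. Stages are numbered from `0`. -/
noncomputable def prob (M : MDP S A) (μ : PMF S) (σ : BehaviorStrategy A) : Measure (ℕ → SA A) :=
  Kernel.trajMeasure (X := fun _ => SA A) (stageLaw μ (σ 0 Fin.elim0)).toMeasure (M.stepKernel σ)

/-- The `l`-discounted payoff: the expectation of `∑ l ^ n * r(sₙ, aₙ)` (stages numbered
from `0`). -/
noncomputable def payoff (M : MDP S A) (l : ℝ) (μ : PMF S) (σ : BehaviorStrategy A) : ℝ :=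
  ∫ ω, ∑' n : ℕ, l ^ n * M.r (ω n).1 (ω n).2 ∂(M.prob μ σ)

/-- The `l`-discounted value: the supremum of the payoff over all behavior strategies. -/
noncomputable def value (M : MDP S A) (l : ℝ) (μ : PMF S) : ℝ :=
  ⨆ σ : BehaviorStrategy A, M.payoff l μ σ

instance (M : MDP S A) (μ : PMF S) (σ : BehaviorStrategy A) :
    IsProbabilityMeasure (M.prob μ σ) := by
  have := PMF.toMeasure.isProbabilityMeasure (stageLaw μ (σ 0 Fin.elim0))
  unfold prob; infer_instance

theorem exists_bound (M : MDP S A) : ∃ C, ∀ x : SA A, |M.r x.1 x.2| ≤ C := by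
  obtain ⟨C, hC⟩ := (Set.finite_range fun x : SA A => |M.r x.1 x.2|).bddAbove
  exact ⟨C, fun x => hC ⟨x, rfl⟩⟩

/-- The discounted sum is integrable, so the payoff is a genuine expectation. -/
theorem summable_and_integrable (M : MDP S A) {l : ℝ} (hl : l ∈ Set.Ico (0 : ℝ) 1) (μ : PMF S)
    (σ : BehaviorStrategy A) :
    (∀ ω : ℕ → SA A, Summable fun n => l ^ n * M.r (ω n).1 (ω n).2) ∧
    Integrable (fun ω : ℕ → SA A => ∑' n : ℕ, l ^ n * M.r (ω n).1 (ω n).2) (M.prob μ σ) := by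
  obtain ⟨C, hC⟩ := M.exists_bound
  have hb : ∀ (ω : ℕ → SA A) n, ‖l ^ n * M.r (ω n).1 (ω n).2‖ ≤ l ^ n * C := fun ω n => by
    rw [norm_mul, norm_pow, Real.norm_of_nonneg hl.1]
    exact mul_le_mul_of_nonneg_left (hC _) (pow_nonneg hl.1 n)
  have hs : HasSum (fun n => l ^ n * C) ((1 - l)⁻¹ * C) :=
    (hasSum_geometric_of_lt_one hl.1 hl.2).mul_right C
  have hsum : ∀ ω : ℕ → SA A, Summable fun n => l ^ n * M.r (ω n).1 (ω n).2 := fun ω =>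
    Summable.of_norm_bounded hs.summable (hb ω)
  refine ⟨hsum, Integrable.of_bound (C := (1 - l)⁻¹ * C) ?_ (ae_of_all _ fun ω =>
    tsum_of_norm_bounded hs (hb ω))⟩
  refine (measurable_of_tendsto_metrizable (f := fun N (ω : ℕ → SA A) =>
    ∑ n ∈ Finset.range N, l ^ n * M.r (ω n).1 (ω n).2) (fun N => ?_)
    (tendsto_pi_nhds.2 fun ω => (hsum ω).hasSum.tendsto_sum_nat)).aestronglyMeasurable
  refine Finset.measurable_sum _ fun n _ => Measurable.const_mul ?_ _
  have : Measurable fun x : SA A => M.r x.1 x.2 := fun _ _ => trivial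
  exact this.comp (measurable_pi_apply n)

/-- The payoffs are bounded, so the value is a genuine supremum. -/
theorem bddAbove_payoff (M : MDP S A) {l : ℝ} (hl : l ∈ Set.Ico (0 : ℝ) 1) (μ : PMF S) :
    BddAbove (Set.range fun σ : BehaviorStrategy A => M.payoff l μ σ) := by
  obtain ⟨C, hC⟩ := M.exists_bound
  refine ⟨(1 - l)⁻¹ * C, ?_⟩
  rintro _ ⟨σ, rfl⟩
  have key := norm_integral_le_of_norm_le_const (μ := M.prob μ σ) (C := (1 - l)⁻¹ * C)
    (f := fun ω => ∑' n : ℕ, l ^ n * M.r (ω n).1 (ω n).2) (ae_of_all _ fun ω =>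
      tsum_of_norm_bounded ((hasSum_geometric_of_lt_one hl.1 hl.2).mul_right C) fun n => by
        rw [norm_mul, norm_pow, Real.norm_of_nonneg hl.1]
        exact mul_le_mul_of_nonneg_left (hC _) (pow_nonneg hl.1 n))
  rw [probReal_univ, mul_one] at key
  exact (le_abs_self _).trans key

end process

/-- The transition matrix induced by a pure stationary strategy. -/
noncomputable def transitionMatrix {S : Type u} {A : S → Type v} (M : MDP S A)
    (σ : PureStationary A) : Matrix S S ℝ :=
  Matrix.of fun s s' => (M.q s (σ s) s').toReal

/-- The vector of stage payoffs induced by a pure stationary strategy. -/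
def payoffVector {S : Type u} {A : S → Type v} (M : MDP S A) (σ : PureStationary A) : S → ℝ :=
  fun s => M.r s (σ s)

end MDP

/-- The set `𝓥` of functions on `[0,1)` that are the value function of some Markov decision process
with finitely many states, finite non-empty action sets, and some prior. -/
def valueFunctions : Set (Set.Ico (0 : ℝ) 1 → ℝ) :=
  {w | ∃ (S : Type u) (A : S → Type v) (_ : Finite S) (_ : ∀ s, Finite (A s))
      (_ : ∀ s, Nonempty (A s)) (M : MDP S A) (μ : PMF S), ∀ l, w l = M.value l μ}

/-- A nonzero real polynomial each of whose complex roots is outside the closed unit ball, or is a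
unit root with multiplicity 1. -/
def AdmissibleDenominator (Q : ℝ[X]) : Prop :=
  Q ≠ 0 ∧ ∀ z : ℂ, (Q.map (algebraMap ℝ ℂ)).IsRoot z →
    1 < ‖z‖ ∨ ((∃ n : ℕ, 0 < n ∧ z ^ n = 1) ∧ (Q.map (algebraMap ℝ ℂ)).rootMultiplicity z = 1)

/-- The set `𝓕` of rational functions `P / Q` with an admissible denominator, as functions
on `[0,1)`. -/
def ratF : Set (Set.Ico (0 : ℝ) 1 → ℝ) :=
  {f | ∃ P Q : ℝ[X], AdmissibleDenominator Q ∧ ∀ l, f l = P.eval (l : ℝ) / Q.eval (l : ℝ)}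

/-- The set `Max 𝓕` of pointwise maxima of finitely many (at least one) functions in `𝓕`. -/
def MaxF : Set (Set.Ico (0 : ℝ) 1 → ℝ) :=
  {w | ∃ T : Set (Set.Ico (0 : ℝ) 1 → ℝ), T.Finite ∧ T ⊆ ratF ∧
      ∀ l, IsGreatest ((fun f => f l) '' T) (w l)}

/-!
The argument rests on two facts: the payoff of a pure stationary strategy is `(1 - l Q)⁻¹ r` for
a row-stochastic matrix `Q`, and for each discount factor some pure stationary strategy is
optimal among all behavior strategies. As there are finitely many pure stationary strategies, the
value is then a finite maximum of rational functions.

*Payoffs.* For any function `w` of the state, a telescoping sum shows that the expectation of `w`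
at the initial state minus the payoff is the discounted sum of the expected gaps
`w(s) - r(s, a) - l ∑ q(s' | s, a) w(s')` (`MDP.hasSum_gap`). This only uses that the expectation
of `w` at the next state depends on the current state-action pair alone
(`MDP.integral_fst_succ`). If the gaps vanish along a pure stationary strategy, its payoff is the
expectation of `w` (`MDP.payoff_eq`); if they are nonnegative, no strategy does better
(`MDP.payoff_le`). A pure stationary strategy maximizing the sum of its payoffs over the initial
states has nonnegative gaps, by policy improvement (`MDP.exists_resolvent_bellman`).

*Roots of `det (1 - X Q)`.* A root `z` gives a nonzero `w` with `w = z Q w`. Comparing sup norms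
excludes `|z| < 1`. If `|z| = 1`, then `Q w = z⁻¹ w`, and strict convexity of the disc lets one move
from an index where `|w|` is maximal to one where `w` is multiplied by `z⁻¹`; there are finitely
many indices, so two powers of `z⁻¹` coincide (`IsRowStochastic.exists_pow_eq_one`).

*Simple poles.* By Cramer's rule the payoff is a polynomial over `det (1 - X Q)`; let `P / D` be
its lowest terms. In the open unit ball the resolvent is at most a constant over `1 - |z|`, which
is incompatible with a multiple root of `D` on the unit circle
(`rootMultiplicity_eq_one_of_growth`).
-/

/-! ### Row-stochastic matrices and their resolvents -/

theorem map_aeval_one_sub_X_smul {ι K : Type*} [DecidableEq ι] [Field K] [Algebra ℝ K]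
    (Q : Matrix ι ι ℝ) (x : K) :
    (1 - (X : ℝ[X]) • Q.map C).map (aeval x) = 1 - x • Q.map (algebraMap ℝ K) := by
  ext i j
  by_cases h : i = j <;> simp [h, mul_comm x]

section stochastic

variable {ι : Type*} [Fintype ι]

/-- `Q` is row-stochastic: its entries are nonnegative and each row sums to `1`. -/
def IsRowStochastic (Q : Matrix ι ι ℝ) : Prop :=
  (∀ i j, 0 ≤ Q i j) ∧ ∀ i, ∑ j, Q i j = 1

/-- In the sup norm, a row-stochastic matrix does not increase complex vectors. -/
theorem IsRowStochastic.norm_sum_le {Q : Matrix ι ι ℝ} (hQ : IsRowStochastic Q) (w : ι → ℂ) {m : ℝ}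
    (hw : ∀ j, ‖w j‖ ≤ m) (i : ι) : ‖∑ j, (Q i j : ℂ) * w j‖ ≤ m := by
  calc ‖∑ j, (Q i j : ℂ) * w j‖ ≤ ∑ j, Q i j * m := by
        refine norm_sum_le_of_le _ fun j _ => ?_
        rw [norm_mul, Complex.norm_real, Real.norm_of_nonneg (hQ.1 i j)]
        exact mul_le_mul_of_nonneg_left (hw j) (hQ.1 i j)
    _ = m := by rw [← Finset.sum_mul, hQ.2, one_mul]

theorem exists_norm_argmax [Nonempty ι] (w : ι → ℂ) : ∃ i, ∀ j, ‖w j‖ ≤ ‖w i‖ :=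
  Finite.exists_max fun i => ‖w i‖

/-- The solution of `w = r + z Q w` grows at most like `1 / (1 - |z|)`. -/
theorem IsRowStochastic.norm_solution_le {Q : Matrix ι ι ℝ} (hQ : IsRowStochastic Q) {z : ℂ}
    (hz : ‖z‖ < 1) {r w : ι → ℂ} {C : ℝ} (hr : ∀ i, ‖r i‖ ≤ C)
    (hw : ∀ i, w i = r i + z * ∑ j, (Q i j : ℂ) * w j) (i : ι) : ‖w i‖ ≤ C / (1 - ‖z‖) := by
  have : Nonempty ι := ⟨i⟩
  obtain ⟨k, hk⟩ := exists_norm_argmax w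
  refine (hk i).trans ?_
  rw [le_div_iff₀ (by linarith)]
  have h1 : ‖w k‖ ≤ C + ‖z‖ * ‖w k‖ := by
    conv_lhs => rw [hw k]
    refine (norm_add_le _ _).trans (add_le_add (hr k) ?_)
    rw [norm_mul]
    exact mul_le_mul_of_nonneg_left (hQ.norm_sum_le w hk k) (norm_nonneg z)
  linarith

/-- Minimum principle: a supersolution of `w = l Q w` is nonnegative. -/
theorem IsRowStochastic.nonneg_of_le {Q : Matrix ι ι ℝ} (hQ : IsRowStochastic Q) {l : ℝ}
    (hl : l ∈ Set.Ico (0 : ℝ) 1) {w : ι → ℝ} (hw : ∀ i, l * ∑ j, Q i j * w j ≤ w i) (i : ι) :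
    0 ≤ w i := by
  have : Nonempty ι := ⟨i⟩
  obtain ⟨k, hk⟩ := Finite.exists_min w
  refine le_trans ?_ (hk i)
  have h1 : w k ≤ ∑ j, Q k j * w j := by
    calc w k = ∑ j, Q k j * w k := by rw [← Finset.sum_mul, hQ.2, one_mul]
      _ ≤ _ := Finset.sum_le_sum fun j _ => mul_le_mul_of_nonneg_left (hk j) (hQ.1 k j)
  have h2 : l * w k ≤ w k := (mul_le_mul_of_nonneg_left h1 hl.1).trans (hw k)
  have h3 := hl.2
  nlinarith

/-- If `Q w = c w` with `|c| = 1`, then from every index at which `|w|` is maximal one can move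
to an index at which the value of `w` is multiplied by `c`: a convex combination of points of a
disc lies on the bounding circle only if it is one of them. -/
theorem IsRowStochastic.exists_eq_mul {Q : Matrix ι ι ℝ} (hQ : IsRowStochastic Q) {c : ℂ}
    (hc : ‖c‖ = 1) {w : ι → ℂ} (hw : ∀ i, ∑ j, (Q i j : ℂ) * w j = c * w i) {i : ι}
    (hi : ∀ j, ‖w j‖ ≤ ‖w i‖) : ∃ j, w j = c * w i := by
  set y := c * w i with hy
  have hny : ‖y‖ = ‖w i‖ := by rw [hy, norm_mul, hc, one_mul]
  have hsum : ∑ j, Q i j * (inner ℝ y (w j)) = ∑ j, Q i j * ‖y‖ ^ 2 := by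
    rw [← Finset.sum_mul, hQ.2, one_mul, ← real_inner_self_eq_norm_sq]
    refine Eq.trans ?_ (congrArg (fun x => inner ℝ y x) (hw i))
    rw [inner_sum]
    refine Finset.sum_congr rfl fun j _ => ?_
    rw [← Complex.real_smul, real_inner_smul_right]
  obtain ⟨j, -, hj⟩ : ∃ j ∈ Finset.univ, 0 < Q i j ∧ ‖y‖ ^ 2 ≤ inner ℝ y (w j) := by
    by_contra! hcon
    have hle : ∀ j ∈ Finset.univ, Q i j * inner ℝ y (w j) ≤ Q i j * ‖y‖ ^ 2 := fun j hj => by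
      rcases (hQ.1 i j).eq_or_lt with h0 | h0
      · simp [← h0]
      · exact mul_le_mul_of_nonneg_left (hcon j hj h0).le h0.le
    obtain ⟨j, hj, hpos⟩ : ∃ j ∈ Finset.univ, 0 < Q i j := by
      by_contra! h
      have := Finset.sum_nonpos h
      rw [hQ.2] at this
      linarith
    exact (Finset.sum_lt_sum hle ⟨j, hj, mul_lt_mul_of_pos_left (hcon j hj hpos) hpos⟩).ne hsum
  refine ⟨j, ?_⟩
  have h1 : ‖w j - y‖ ^ 2 ≤ 0 := by
    rw [norm_sub_sq_real, real_inner_comm]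
    have h2 : ‖w j‖ ^ 2 ≤ ‖y‖ ^ 2 := by
      rw [hny]; exact pow_le_pow_left₀ (norm_nonneg _) (hi j) 2
    linarith [hj.2]
  have h3 : ‖w j - y‖ = 0 := by
    have := sq_nonneg ‖w j - y‖
    exact pow_eq_zero_iff two_ne_zero |>.1 (le_antisymm h1 this)
  exact sub_eq_zero.1 (norm_eq_zero.1 h3)

/-- An eigenvalue of modulus `1` of a row-stochastic matrix is a root of unity. -/
theorem IsRowStochastic.exists_pow_eq_one {Q : Matrix ι ι ℝ} (hQ : IsRowStochastic Q) {c : ℂ}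
    (hc : ‖c‖ = 1) {w : ι → ℂ} (hw0 : w ≠ 0) (hw : ∀ i, ∑ j, (Q i j : ℂ) * w j = c * w i) :
    ∃ n : ℕ, 0 < n ∧ c ^ n = 1 := by
  obtain ⟨i₁, hi₁⟩ := Function.ne_iff.1 hw0
  have : Nonempty ι := ⟨i₁⟩
  obtain ⟨i, hi⟩ := exists_norm_argmax w
  have hwi : w i ≠ 0 := fun h => hi₁ (by simpa [h] using hi i₁)
  have hk : ∀ k : ℕ, ∃ j, w j = c ^ k * w i := fun k => by
    induction k with
    | zero => exact ⟨i, by simp⟩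
    | succ k ih =>
      obtain ⟨j, hj⟩ := ih
      have hnj : ‖w j‖ = ‖w i‖ := by rw [hj, norm_mul, norm_pow, hc, one_pow, one_mul]
      obtain ⟨j', hj'⟩ := hQ.exists_eq_mul hc hw (i := j) fun k => (hi k).trans hnj.ge
      exact ⟨j', by rw [hj', hj, pow_succ']; ring⟩
  choose f hf using hk
  obtain ⟨a, b, hab, hfab⟩ := Finite.exists_ne_map_eq_of_infinite f
  have hpow : c ^ a = c ^ b := by
    have := (hf a).symm.trans ((congrArg w hfab).trans (hf b))
    exact mul_right_cancel₀ hwi this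
  have hc0 : c ≠ 0 := by rintro rfl; simp at hc
  rcases lt_or_gt_of_ne hab with h | h
  · refine ⟨b - a, Nat.sub_pos_of_lt h, ?_⟩
    rw [pow_sub₀ _ hc0 h.le, ← hpow, mul_inv_cancel₀ (pow_ne_zero _ hc0)]
  · refine ⟨a - b, Nat.sub_pos_of_lt h, ?_⟩
    rw [pow_sub₀ _ hc0 h.le, hpow, mul_inv_cancel₀ (pow_ne_zero _ hc0)]

variable [DecidableEq ι]

theorem one_sub_smul_mulVec_apply {K : Type*} [Field K] [Algebra ℝ K] (Q : Matrix ι ι ℝ) (x : K)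
    (w : ι → K) (i : ι) : ((1 - x • Q.map (algebraMap ℝ K)).mulVec w) i =
      w i - x * ∑ j, algebraMap ℝ K (Q i j) * w j := by
  rw [Matrix.sub_mulVec, Matrix.one_mulVec, Matrix.smul_mulVec]
  simp [Matrix.mulVec, dotProduct]

theorem aeval_charpolyRev {K : Type*} [Field K] [Algebra ℝ K] (Q : Matrix ι ι ℝ) (x : K) :
    aeval x Q.charpolyRev = (1 - x • Q.map (algebraMap ℝ K)).det := by
  rw [Matrix.charpolyRev, AlgHom.map_det, ← map_aeval_one_sub_X_smul]
  rfl

/-- A root `z` of `det (1 - X Q)` gives a vector `w` with `w = z Q w`. For `|z| < 1` the resolvent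
bound kills `w`; for `|z| = 1` it is an eigenvector with eigenvalue `z⁻¹` of modulus `1`. -/
theorem IsRowStochastic.root_charpolyRev {Q : Matrix ι ι ℝ} (hQ : IsRowStochastic Q) {z : ℂ}
    (hz : aeval z Q.charpolyRev = 0) : 1 < ‖z‖ ∨ ∃ n : ℕ, 0 < n ∧ z ^ n = 1 := by
  rw [aeval_charpolyRev] at hz
  obtain ⟨w, hw0, hw⟩ := Matrix.exists_mulVec_eq_zero_iff.2 hz
  have hw' : ∀ i, w i = z * ∑ j, (Q i j : ℂ) * w j := fun i =>
    sub_eq_zero.1 ((one_sub_smul_mulVec_apply Q z w i).symm.trans (congrFun hw i))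
  rcases lt_trichotomy ‖z‖ 1 with h | h | h
  · refine absurd (funext fun i => ?_) hw0
    have := hQ.norm_solution_le (r := 0) (C := 0) h (by simp) (by simpa using hw') i
    simpa using this
  · right
    have hz0 : z ≠ 0 := by rintro rfl; simp at h
    obtain ⟨n, hn, h1⟩ := hQ.exists_pow_eq_one (c := z⁻¹) (by simp [h]) hw0 fun i => by
      rw [hw' i, inv_mul_cancel_left₀ hz0]
    exact ⟨n, hn, by simpa using h1⟩
  · exact Or.inl h

theorem IsRowStochastic.det_ne_zero {Q : Matrix ι ι ℝ} (hQ : IsRowStochastic Q) {z : ℂ}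
    (hz : ‖z‖ < 1) : (1 - z • Q.map (algebraMap ℝ ℂ)).det ≠ 0 := fun h => by
  rw [← aeval_charpolyRev] at h
  rcases hQ.root_charpolyRev h with h1 | ⟨n, hn, h1⟩
  · exact absurd hz h1.not_gt
  · have := pow_lt_one₀ (norm_nonneg z) hz hn.ne'
    rw [← norm_pow, h1, norm_one] at this
    exact this.false

theorem IsRowStochastic.isUnit_one_sub {Q : Matrix ι ι ℝ} (hQ : IsRowStochastic Q) {l : ℝ}
    (hl : l ∈ Set.Ico (0 : ℝ) 1) : IsUnit (1 - l • Q) := by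
  rw [Matrix.isUnit_iff_isUnit_det, isUnit_iff_ne_zero]
  intro h
  have h1 : aeval l Q.charpolyRev = 0 := by
    rw [aeval_charpolyRev]; exact h
  refine hQ.det_ne_zero (z := (l : ℂ)) ?_ ?_
  · rw [Complex.norm_real, Real.norm_of_nonneg hl.1]; exact hl.2
  · have h2 := aeval_algebraMap_apply ℂ l Q.charpolyRev
    rw [h1, map_zero] at h2
    rw [← aeval_charpolyRev]
    exact h2

/-- The numerator, by Cramer's rule, of `∑ i, m i * ((1 - x Q)⁻¹ r) i` over the denominator
`det (1 - x Q)`. -/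
noncomputable def cramerNumerator (Q : Matrix ι ι ℝ) (m r : ι → ℝ) : ℝ[X] :=
  ∑ i, C (m i) * ((1 - (X : ℝ[X]) • Q.map C).adjugate.mulVec fun j => C (r j)) i

theorem aeval_cramerNumerator {K : Type*} [Field K] [Algebra ℝ K] (Q : Matrix ι ι ℝ) (m r : ι → ℝ)
    {x : K} {w : ι → K}
    (hw : (1 - x • Q.map (algebraMap ℝ K)).mulVec w = fun j => algebraMap ℝ K (r j)) :
    aeval x (cramerNumerator Q m r) =
      aeval x Q.charpolyRev * ∑ i, algebraMap ℝ K (m i) * w i := by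
  have hadj : ∀ i j, aeval x ((1 - (X : ℝ[X]) • Q.map C).adjugate i j) =
      (1 - x • Q.map (algebraMap ℝ K)).adjugate i j := fun i j => by
    have := congrFun (congrFun (AlgHom.map_adjugate (aeval x) (1 - (X : ℝ[X]) • Q.map C)) i) j
    rw [← map_aeval_one_sub_X_smul]
    exact this
  rw [cramerNumerator, map_sum, Finset.mul_sum]
  refine Finset.sum_congr rfl fun i _ => ?_
  have h2 : aeval x (((1 - (X : ℝ[X]) • Q.map C).adjugate.mulVec fun j => C (r j)) i) =
      aeval x Q.charpolyRev * w i := by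
    have h3 : (1 - x • Q.map (algebraMap ℝ K)).adjugate.mulVec (fun j => algebraMap ℝ K (r j)) =
        (1 - x • Q.map (algebraMap ℝ K)).det • w := by
      rw [← hw, Matrix.mulVec_mulVec, Matrix.adjugate_mul, Matrix.smul_mulVec, Matrix.one_mulVec]
    have h4 := congrFun h3 i
    rw [aeval_charpolyRev]
    simp only [Matrix.mulVec, dotProduct, Pi.smul_apply, smul_eq_mul] at h4 ⊢
    rw [← h4, map_sum]
    refine Finset.sum_congr rfl fun j _ => ?_
    rw [map_mul, hadj, aeval_C]
  rw [map_mul, aeval_C, h2]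
  ring

end stochastic

/-! ### Poles on the unit circle -/

/-- A fraction in lowest terms that grows at most like `1 / (1 - |z|)` in the open unit ball has
at most simple poles on the unit circle: along the radius to a double root of `D`, the
numerator `P = D F` would tend to `0`. -/
theorem rootMultiplicity_eq_one_of_growth {P D : ℂ[X]} (hPD : IsCoprime P D) (hD : D ≠ 0)
    {F : ℂ → ℂ} {C : ℝ} (hF : ∀ z : ℂ, ‖z‖ < 1 → ‖F z‖ ≤ C / (1 - ‖z‖))
    (heq : ∀ z : ℂ, ‖z‖ < 1 → P.eval z = D.eval z * F z) {ζ : ℂ} (hζ : ‖ζ‖ = 1)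
    (hroot : D.IsRoot ζ) : D.rootMultiplicity ζ = 1 := by
  have hpos : 0 < D.rootMultiplicity ζ := (rootMultiplicity_pos hD).2 hroot
  by_contra hne
  obtain ⟨E, hE⟩ : (X - Polynomial.C ζ) ^ 2 ∣ D :=
    (le_rootMultiplicity_iff hD).1 (by omega)
  -- `D` contributes `(1 - t) ^ 2` and `F` at most `C / (1 - t)`, so a factor `1 - t` remains.
  have hbound : ∀ t ∈ Set.Ioo (0 : ℝ) 1,
      ‖P.eval ((t : ℂ) * ζ)‖ ≤ (1 - t) * (C * ‖E.eval ((t : ℂ) * ζ)‖) := fun t ht => by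
    have hnorm : ‖(t : ℂ) * ζ‖ = t := by
      rw [norm_mul, hζ, mul_one, Complex.norm_real, Real.norm_of_nonneg ht.1.le]
    have hlt : ‖(t : ℂ) * ζ‖ < 1 := hnorm.trans_lt ht.2
    have h1 : 0 < 1 - t := by linarith [ht.2]
    have h2 := hF _ hlt
    rw [hnorm, le_div_iff₀ h1] at h2
    have h3 : ‖(t : ℂ) * ζ - ζ‖ = 1 - t := by
      have : (t : ℂ) * ζ - ζ = -(((1 - t : ℝ) : ℂ) * ζ) := by push_cast; ring
      rw [this, norm_neg, norm_mul, hζ, mul_one, Complex.norm_real, Real.norm_of_nonneg h1.le]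
    rw [heq _ hlt, hE]
    simp only [eval_mul, eval_pow, eval_sub, eval_X, eval_C, norm_mul, norm_pow]
    rw [h3]
    calc (1 - t) ^ 2 * ‖E.eval ((t : ℂ) * ζ)‖ * ‖F ((t : ℂ) * ζ)‖
        = (1 - t) * ((‖F ((t : ℂ) * ζ)‖ * (1 - t)) * ‖E.eval ((t : ℂ) * ζ)‖) := by ring
      _ ≤ _ := by gcongr
  have hP0 : P.eval ζ = 0 := by
    have hev : ∀ R : ℂ[X], Continuous fun t : ℝ => R.eval ((t : ℂ) * ζ) := fun R =>
      R.continuous.comp (by fun_prop)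
    have hl : Filter.Tendsto (fun t : ℝ => ‖P.eval ((t : ℂ) * ζ)‖) (nhdsWithin 1 (Set.Iio 1))
        (nhds ‖P.eval ζ‖) := by
      have := ((hev P).norm.tendsto 1).mono_left (nhdsWithin_le_nhds (s := Set.Iio (1 : ℝ)))
      simpa using this
    have hr : Filter.Tendsto (fun t : ℝ => (1 - t) * (C * ‖E.eval ((t : ℂ) * ζ)‖))
        (nhdsWithin 1 (Set.Iio 1)) (nhds 0) := by
      have hc : Continuous fun t : ℝ => (1 - t) * (C * ‖E.eval ((t : ℂ) * ζ)‖) :=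
        (continuous_const.sub continuous_id).mul (continuous_const.mul (hev E).norm)
      have := (hc.tendsto 1).mono_left (nhdsWithin_le_nhds (s := Set.Iio (1 : ℝ)))
      simpa using this
    have h0 : ‖P.eval ζ‖ ≤ 0 := by
      refine le_of_tendsto_of_tendsto hl hr ?_
      filter_upwards [Ioo_mem_nhdsLT (zero_lt_one (α := ℝ))] with t ht using hbound t ht
    exact norm_le_zero_iff.1 h0
  obtain ⟨a, b, hab⟩ := hPD
  have := congrArg (eval ζ) hab
  rw [eval_add, eval_mul, eval_mul, hP0, hroot.eq_zero] at this
  simp at this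

section stochastic

variable {ι : Type*} [Fintype ι] [DecidableEq ι]

/-- `∑ i, m i * ((1 - x Q)⁻¹ r) i` is a fraction in lowest terms whose denominator is admissible
and divides `det (1 - x Q)`. -/
theorem IsRowStochastic.exists_coprime_fraction {Q : Matrix ι ι ℝ} (hQ : IsRowStochastic Q)
    (m r : ι → ℝ) : ∃ P D : ℝ[X], IsCoprime P D ∧ D ∣ Q.charpolyRev ∧ AdmissibleDenominator D ∧
      ∀ l ∈ Set.Ico (0 : ℝ) 1,
        ∑ i, m i * ((1 - l • Q)⁻¹.mulVec r) i = P.eval l / D.eval l := by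
  set Δ := Q.charpolyRev with hΔ
  set N := cramerNumerator Q m r
  have hΔ0 : Δ ≠ 0 := fun h => by
    have : eval 0 Q.charpolyRev = 1 := Matrix.eval_charpolyRev
    rw [← hΔ, h, eval_zero] at this
    exact zero_ne_one this
  obtain ⟨P, hP⟩ := EuclideanDomain.gcd_dvd_left N Δ
  obtain ⟨D, hD⟩ := EuclideanDomain.gcd_dvd_right N Δ
  set G := EuclideanDomain.gcd N Δ
  have hG0 : G ≠ 0 := fun h => hΔ0 (by rw [hD, h, zero_mul])
  have hD0 : D ≠ 0 := fun h => hΔ0 (by rw [hD, h, mul_zero])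
  have hPD : IsCoprime P D := by
    refine ⟨EuclideanDomain.gcdA N Δ, EuclideanDomain.gcdB N Δ, mul_left_cancel₀ hG0 ?_⟩
    have := EuclideanDomain.gcd_eq_gcd_ab N Δ
    calc G * (EuclideanDomain.gcdA N Δ * P + EuclideanDomain.gcdB N Δ * D)
        = (G * P) * EuclideanDomain.gcdA N Δ + (G * D) * EuclideanDomain.gcdB N Δ := by ring
      _ = N * EuclideanDomain.gcdA N Δ + Δ * EuclideanDomain.gcdB N Δ := by rw [← hP, ← hD]
      _ = G * 1 := by rw [mul_one]; exact this.symm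
  have hroot : ∀ z : ℂ, aeval z D = 0 → 1 < ‖z‖ ∨ ∃ n : ℕ, 0 < n ∧ z ^ n = 1 := fun z hz =>
    hQ.root_charpolyRev (by rw [← hΔ, hD, map_mul, hz, mul_zero])
  refine ⟨P, D, hPD, ⟨G, by rw [mul_comm]; exact hD⟩, ⟨hD0, fun z hz => ?_⟩, fun l hl => ?_⟩
  · have hz' : aeval z D = 0 := by rwa [IsRoot, eval_map_algebraMap] at hz
    rcases hroot z hz' with h | ⟨n, hn, hzn⟩
    · exact Or.inl h
    refine Or.inr ⟨⟨n, hn, hzn⟩, ?_⟩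
    have hnorm : ‖z‖ = 1 := Complex.norm_eq_one_of_pow_eq_one hzn hn.ne'
    let w : ℂ → ι → ℂ := fun x =>
      (1 - x • Q.map (algebraMap ℝ ℂ))⁻¹.mulVec fun j => algebraMap ℝ ℂ (r j)
    have hw : ∀ x : ℂ, ‖x‖ < 1 →
        (1 - x • Q.map (algebraMap ℝ ℂ)).mulVec (w x) = fun j => algebraMap ℝ ℂ (r j) :=
      fun x hx => by
        rw [Matrix.mulVec_mulVec, Matrix.mul_nonsing_inv _
          (isUnit_iff_ne_zero.2 (hQ.det_ne_zero hx)), Matrix.one_mulVec]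
    obtain ⟨B, hB⟩ := (Set.finite_range fun i => ‖(algebraMap ℝ ℂ (r i))‖).bddAbove
    refine rootMultiplicity_eq_one_of_growth (P := P.map (algebraMap ℝ ℂ))
      (D := D.map (algebraMap ℝ ℂ)) (F := fun x => ∑ i, algebraMap ℝ ℂ (m i) * w x i) (C := ∑ i, ‖algebraMap ℝ ℂ (m i)‖ * B)
      (hPD.map (mapRingHom (algebraMap ℝ ℂ)))
      (by rwa [Ne, Polynomial.map_eq_zero]) (fun x hx => ?_) (fun x hx => ?_) hnorm hz
    · rw [Finset.sum_div]
      refine norm_sum_le_of_le _ fun i _ => ?_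
      rw [norm_mul, mul_div_assoc]
      refine mul_le_mul_of_nonneg_left ?_ (norm_nonneg _)
      refine hQ.norm_solution_le hx (r := fun j => algebraMap ℝ ℂ (r j))
        (fun j => hB ⟨j, rfl⟩) (fun j => ?_) i
      have := congrFun (hw x hx) j
      rw [one_sub_smul_mulVec_apply] at this
      exact sub_eq_iff_eq_add.1 this
    · have hN := aeval_cramerNumerator Q m r (hw x hx)
      have hGx : aeval x G ≠ 0 := fun h => by
        refine hQ.det_ne_zero hx ?_
        rw [← aeval_charpolyRev, ← hΔ, hD, map_mul, h, zero_mul]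
      rw [eval_map_algebraMap, eval_map_algebraMap]
      refine mul_left_cancel₀ hGx ?_
      rw [← map_mul, ← hP, ← mul_assoc, ← map_mul, ← hD]
      exact hN
  · have hdet := (Matrix.isUnit_iff_isUnit_det _).1 (hQ.isUnit_one_sub hl)
    have hΔl : aeval l Δ = (1 - l • Q).det := by rw [hΔ, aeval_charpolyRev]; rfl
    have hN := aeval_cramerNumerator Q m r (x := l) (w := (1 - l • Q)⁻¹.mulVec r) (by
      have : Q.map (algebraMap ℝ ℝ) = Q := rfl
      rw [this, Matrix.mulVec_mulVec, Matrix.mul_nonsing_inv _ hdet, Matrix.one_mulVec]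
      rfl)
    have hΔne : aeval l G * aeval l D ≠ 0 := by
      rw [← map_mul, ← hD, hΔl]; exact hdet.ne_zero
    rw [← Polynomial.coe_aeval_eq_eval, eq_div_iff (right_ne_zero_of_mul hΔne)]
    refine mul_left_cancel₀ (left_ne_zero_of_mul hΔne) ?_
    have e1 : aeval l N = aeval l G * aeval l P := by rw [← map_mul, ← hP]
    have e2 : aeval l Δ = aeval l G * aeval l D := by rw [← map_mul, ← hD]
    have e3 : aeval l N = aeval l Δ * ∑ i, m i * ((1 - l • Q)⁻¹.mulVec r) i := hN
    rw [← e1, e3, e2]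
    ring

end stochastic

/-! ### The process of states and actions -/

namespace MDP

section law

variable {S : Type u} {A : S → Type v}

theorem measurable_SA {β : Type*} [MeasurableSpace β] (f : SA A → β) : Measurable f :=
  fun _ _ => trivial

theorem measurable_eval (f : SA A → ℝ) (n : ℕ) : Measurable fun ω : ℕ → SA A => f (ω n) :=
  (measurable_SA f).comp (measurable_pi_apply n)

theorem map_fst_stageLaw (p : PMF S) (α : (s : S) → PMF (A s)) :
    (stageLaw p α).map (fun x : SA A => x.1) = p := by
  have h : ∀ s, ((α s).map fun a => (⟨s, a⟩ : SA A)).map (fun x : SA A => x.1) = PMF.pure s :=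
    fun s => (PMF.map_comp _ _ _).trans (PMF.map_const _ _)
  refine (PMF.map_bind _ _ _).trans ((congrArg p.bind (funext h)).trans (PMF.bind_pure p))

theorem integral_stageLaw [Fintype S] (p : PMF S) (α : (s : S) → PMF (A s)) (w : S → ℝ) :
    ∫ x, w x.1 ∂(stageLaw p α).toMeasure = ∑ s, (p s).toReal * w s := by
  let _ : MeasurableSpace S := ⊤
  have hfst : Measurable (fun x : SA A => x.1) := fun _ _ => trivial
  have hw : Measurable w := fun _ _ => trivial
  have h := integral_map (μ := (stageLaw p α).toMeasure) hfst.aemeasurable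
    (f := w) hw.aestronglyMeasurable
  rw [PMF.toMeasure_map _ _ hfst, map_fst_stageLaw, PMF.integral_eq_sum] at h
  exact h.symm

theorem ae_stageLaw_pure (p : PMF S) (σ : PureStationary A) :
    ∀ᵐ x ∂(stageLaw p fun s => PMF.pure (σ s)).toMeasure, x.2 = σ x.1 := by
  rw [ae_iff, PMF.toMeasure_apply_eq_zero_iff _ (by trivial), Set.disjoint_left]
  rintro ⟨s, a⟩ hx hne
  obtain ⟨s', -, hs'⟩ := (PMF.mem_support_bind_iff _ _ _).1 hx
  obtain ⟨a', ha', h⟩ := (PMF.mem_support_map_iff _ _ _).1 hs'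
  obtain rfl := (PMF.mem_support_pure_iff _ _).1 ha'
  cases h
  exact hne rfl

end law

section process

variable {S : Type u} {A : S → Type v} [∀ s, Finite (A s)]

/-- The first coordinate has the law prescribed by the prior and the first mixed action. -/
theorem map_eval_zero_prob [Finite S] (M : MDP S A) (μ : PMF S) (σ : BehaviorStrategy A) :
    (M.prob μ σ).map (fun ω => ω 0) = (stageLaw μ (σ 0 Fin.elim0)).toMeasure := by
  have h := Kernel.traj_map_frestrictLe (X := fun _ => SA A) (κ := M.stepKernel σ) 0 0
  rw [Kernel.partialTraj_self] at h
  have h2 : (M.prob μ σ).map (Preorder.frestrictLe (π := fun _ => SA A) 0) =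
      (stageLaw μ (σ 0 Fin.elim0)).toMeasure.map
        (MeasurableEquiv.piUnique (fun _ : Finset.Iic 0 => SA A)).symm := by
    rw [prob, Kernel.trajMeasure, Measure.map_comp _ _ (by fun_prop), h, Measure.id_comp]
  have h3 := congrArg
    (Measure.map fun x : Finset.Iic 0 → SA A => x ⟨0, Finset.mem_Iic.2 le_rfl⟩) h2
  rw [Measure.map_map (by fun_prop) (by fun_prop), Measure.map_map (by fun_prop) (by fun_prop)] at h3
  refine Eq.trans h3 ?_
  exact Measure.map_id

theorem map_frestrictLe_prob_compProd_stepKernel [Finite S] (M : MDP S A) (μ : PMF S) (σ : BehaviorStrategy A) (n : ℕ) :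
    ((M.prob μ σ).map (Preorder.frestrictLe (π := fun _ => SA A) n) ⊗ₘ M.stepKernel σ n) =
      (M.prob μ σ).map fun ω => (Preorder.frestrictLe (π := fun _ => SA A) n ω, ω (n + 1)) := by
  have := PMF.toMeasure.isProbabilityMeasure (stageLaw μ (σ 0 Fin.elim0))
  exact Kernel.map_frestrictLe_trajMeasure_compProd_eq_map_trajMeasure

theorem exists_norm_le [Finite S] (f : SA A → ℝ) : ∃ C, ∀ x, ‖f x‖ ≤ C := by
  obtain ⟨C, hC⟩ := (Set.finite_range fun x : SA A => ‖f x‖).bddAbove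
  exact ⟨C, fun x => hC ⟨x, rfl⟩⟩

theorem integrable_eval [Finite S] (M : MDP S A) (μ : PMF S) (σ : BehaviorStrategy A)
    (f : SA A → ℝ) (n : ℕ) : Integrable (fun ω => f (ω n)) (M.prob μ σ) := by
  obtain ⟨C, hC⟩ := exists_norm_le f
  exact Integrable.of_bound (measurable_eval f n).aestronglyMeasurable C
    (ae_of_all _ fun ω => hC _)

/-- A pure stationary strategy almost surely plays its own action at every stage. -/
theorem ae_mem_graph [Finite S] (M : MDP S A) (μ : PMF S) (σ : PureStationary A) (n : ℕ) :
    ∀ᵐ ω ∂M.prob μ σ.toBehavior, (ω n).2 = σ (ω n).1 := by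
  have hG : MeasurableSet {x : SA A | x.2 = σ x.1} := trivial
  cases n with
  | zero =>
    have h := ae_stageLaw_pure μ σ
    have h0 := M.map_eval_zero_prob μ σ.toBehavior
    change ∀ᵐ x ∂(stageLaw μ (σ.toBehavior 0 Fin.elim0)).toMeasure, _ at h
    rw [← h0] at h
    exact (ae_map_iff (measurable_pi_apply 0).aemeasurable hG).1 h
  | succ n =>
    have hG' : MeasurableSet {z : (Finset.Iic n → SA A) × SA A | z.2.2 = σ z.2.1} :=
      measurable_snd hG
    have h := Measure.ae_compProd_of_ae_ae
      (μ := (M.prob μ σ.toBehavior).map (Preorder.frestrictLe (π := fun _ => SA A) n))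
      (κ := M.stepKernel σ.toBehavior n) hG' (ae_of_all _ fun h => ae_stageLaw_pure _ σ)
    rw [map_frestrictLe_prob_compProd_stepKernel] at h
    exact (ae_map_iff (by fun_prop) hG').1 h

variable [Fintype S]

/-- The expectation of `w` at the state that follows the state-action pair `x`. -/
noncomputable def next (M : MDP S A) (w : S → ℝ) (x : SA A) : ℝ :=
  ∑ s, (M.q x.1 x.2 s).toReal * w s

theorem integral_fst_zero (M : MDP S A) (μ : PMF S) (σ : BehaviorStrategy A) (w : S → ℝ) :
    ∫ ω, w (ω 0).1 ∂M.prob μ σ = ∑ s, (μ s).toReal * w s := by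
  have h := integral_map (μ := M.prob μ σ) (φ := fun ω => ω 0)
    (measurable_pi_apply 0).aemeasurable (f := fun x : SA A => w x.1)
    (measurable_SA _).aestronglyMeasurable
  rw [map_eval_zero_prob, integral_stageLaw] at h
  exact h.symm

/-- Markov property in the mean: whatever the strategy, the expectation of `w` at the next state
depends only on the law of the current state-action pair. -/
theorem integral_fst_succ (M : MDP S A) (μ : PMF S) (σ : BehaviorStrategy A) (w : S → ℝ) (n : ℕ) :
    ∫ ω, w (ω (n + 1)).1 ∂M.prob μ σ = ∫ ω, M.next w (ω n) ∂M.prob μ σ := by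
  have hf : Measurable fun z : (Finset.Iic n → SA A) × SA A => w z.2.1 :=
    (measurable_SA fun x : SA A => w x.1).comp measurable_snd
  have hφ : Measurable fun ω : ℕ → SA A =>
      (Preorder.frestrictLe (π := fun _ => SA A) n ω, ω (n + 1)) := by fun_prop
  have h := integral_map (μ := M.prob μ σ) hφ.aemeasurable hf.aestronglyMeasurable
  have hint : Integrable (fun z : (Finset.Iic n → SA A) × SA A => w z.2.1)
      ((M.prob μ σ).map (Preorder.frestrictLe (π := fun _ => SA A) n) ⊗ₘ M.stepKernel σ n) := by
    rw [map_frestrictLe_prob_compProd_stepKernel, integrable_map_measure hf.aestronglyMeasurable hφ.aemeasurable]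
    exact M.integrable_eval μ σ (fun x => w x.1) (n + 1)
  rw [← map_frestrictLe_prob_compProd_stepKernel, Measure.integral_compProd hint] at h
  have hstep : ∀ y : Finset.Iic n → SA A, ∫ x, w x.1 ∂M.stepKernel σ n y =
      M.next w (y ⟨n, Finset.mem_Iic.2 le_rfl⟩) := fun y => integral_stageLaw _ _ w
  simp only [hstep] at h
  rw [integral_map (by fun_prop)] at h
  · exact h.symm
  · exact ((measurable_SA (M.next w)).comp
      (measurable_pi_apply (⟨n, Finset.mem_Iic.2 le_rfl⟩ : Finset.Iic n))).aestronglyMeasurable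

theorem hasSum_payoff (M : MDP S A) {l : ℝ} (hl : l ∈ Set.Ico (0 : ℝ) 1) (μ : PMF S)
    (σ : BehaviorStrategy A) :
    HasSum (fun n => l ^ n * ∫ ω, M.r (ω n).1 (ω n).2 ∂M.prob μ σ) (M.payoff l μ σ) := by
  obtain ⟨C, hC⟩ := M.exists_bound
  have hint := fun n => (M.integrable_eval μ σ (fun x => M.r x.1 x.2) n).const_mul (l ^ n)
  have h := hasSum_integral_of_summable_integral_norm hint ?_
  · simp only [integral_const_mul] at h
    exact h
  · refine Summable.of_nonneg_of_le (fun n => integral_nonneg fun _ => norm_nonneg _) (fun n => ?_)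
      ((summable_geometric_of_lt_one hl.1 hl.2).mul_right C)
    calc ∫ ω, ‖l ^ n * M.r (ω n).1 (ω n).2‖ ∂M.prob μ σ ≤ ∫ _, l ^ n * C ∂M.prob μ σ := by
          refine integral_mono (hint n).norm (integrable_const _) fun ω => ?_
          change ‖l ^ n * M.r (ω n).1 (ω n).2‖ ≤ l ^ n * C
          rw [norm_mul, Real.norm_of_nonneg (pow_nonneg hl.1 n)]
          exact mul_le_mul_of_nonneg_left (hC (ω n)) (pow_nonneg hl.1 n)
      _ = l ^ n * C := by simp

/-- Verification identity: the payoff falls short of the expectation of `w` at the initial state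
by the discounted sum of the expected gaps `w(s) - r(s, a) - l ∑ q(s' | s, a) w(s')` in the Bellman
equation. -/
theorem hasSum_gap (M : MDP S A) {l : ℝ} (hl : l ∈ Set.Ico (0 : ℝ) 1) (μ : PMF S)
    (σ : BehaviorStrategy A) (w : S → ℝ) :
    HasSum (fun n => l ^ n *
        ∫ ω, (w (ω n).1 - M.r (ω n).1 (ω n).2 - l * M.next w (ω n)) ∂M.prob μ σ)
      (∑ s, (μ s).toReal * w s - M.payoff l μ σ) := by
  set b : ℕ → ℝ := fun n => ∫ ω, w (ω n).1 ∂M.prob μ σ with hb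
  obtain ⟨C, hC⟩ := exists_norm_le fun x : SA A => w x.1
  have hbC : ∀ n, ‖b n‖ ≤ C := fun n => by
    simpa using norm_integral_le_of_norm_le_const (μ := M.prob μ σ)
      (f := fun ω => w (ω n).1) (ae_of_all _ fun ω => hC (ω n))
  have hsum : Summable fun n => l ^ n * b n := by
    refine Summable.of_norm_bounded ((summable_geometric_of_lt_one hl.1 hl.2).mul_right C)
      fun n => ?_
    rw [norm_mul, Real.norm_of_nonneg (pow_nonneg hl.1 n)]
    exact mul_le_mul_of_nonneg_left (hbC n) (pow_nonneg hl.1 n)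
  have hshift := (hasSum_nat_add_iff' 1).2 hsum.hasSum
  have h := (hsum.hasSum.sub hshift).sub (M.hasSum_payoff hl μ σ)
  have hb0 : b 0 = ∑ s, (μ s).toReal * w s := M.integral_fst_zero μ σ w
  rw [Finset.sum_range_one, pow_zero, one_mul, sub_sub_cancel, hb0] at h
  refine Eq.mp (congrArg (HasSum · _) (funext fun n => ?_)) h
  have i1 := M.integrable_eval μ σ (fun x => w x.1) n
  have i2 := M.integrable_eval μ σ (fun x => M.r x.1 x.2) n
  have i3 := (M.integrable_eval μ σ (M.next w) n).const_mul l
  have hgap : ∫ ω, (w (ω n).1 - M.r (ω n).1 (ω n).2 - l * M.next w (ω n)) ∂M.prob μ σ =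
      b n - ∫ ω, M.r (ω n).1 (ω n).2 ∂M.prob μ σ - l * b (n + 1) := by
    refine (integral_sub (i1.sub i2) i3).trans (congrArg₂ (· - ·) (integral_sub i1 i2) ?_)
    rw [integral_const_mul, ← integral_fst_succ]
  rw [hgap]
  ring

/-- A solution `w` of the Bellman inequality bounds the payoff of every behavior strategy. -/
theorem payoff_le (M : MDP S A) {l : ℝ} (hl : l ∈ Set.Ico (0 : ℝ) 1) (μ : PMF S)
    (σ : BehaviorStrategy A) {w : S → ℝ}
    (hw : ∀ x : SA A, M.r x.1 x.2 + l * M.next w x ≤ w x.1) :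
    M.payoff l μ σ ≤ ∑ s, (μ s).toReal * w s := by
  refine sub_nonneg.1 ((M.hasSum_gap hl μ σ w).nonneg fun n =>
    mul_nonneg (pow_nonneg hl.1 n) (integral_nonneg fun ω => ?_))
  have := hw (ω n)
  change 0 ≤ w (ω n).1 - M.r (ω n).1 (ω n).2 - l * M.next w (ω n)
  linarith

/-- The fixed point equation of a pure stationary strategy determines its payoff. -/
theorem payoff_eq (M : MDP S A) {l : ℝ} (hl : l ∈ Set.Ico (0 : ℝ) 1) (μ : PMF S)
    (σ : PureStationary A) {w : S → ℝ}
    (hw : ∀ s, w s = M.r s (σ s) + l * M.next w ⟨s, σ s⟩) :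
    M.payoff l μ σ.toBehavior = ∑ s, (μ s).toReal * w s := by
  have h := M.hasSum_gap hl μ σ.toBehavior w
  have h0 : ∀ n, ∫ ω, (w (ω n).1 - M.r (ω n).1 (ω n).2 - l * M.next w (ω n))
      ∂M.prob μ σ.toBehavior = 0 := fun n => by
    refine integral_eq_zero_of_ae ?_
    filter_upwards [M.ae_mem_graph μ σ n] with ω hω
    generalize ω n = x at hω
    obtain ⟨s, a⟩ := x
    change a = σ s at hω
    subst hω
    change w s - M.r s (σ s) - l * M.next w ⟨s, σ s⟩ = 0
    linarith [hw s]
  simp only [h0, mul_zero] at h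
  exact (sub_eq_zero.1 (h.unique hasSum_zero)).symm

end process
end MDP

/-! ### Pure stationary strategies -/

namespace MDP

variable {S : Type u} {A : S → Type v} [Fintype S]

theorem isRowStochastic_transitionMatrix (M : MDP S A) (σ : PureStationary A) :
    IsRowStochastic (M.transitionMatrix σ) := by
  refine ⟨fun s s' => ENNReal.toReal_nonneg, fun s => ?_⟩
  change ∑ s', (M.q s (σ s) s').toReal = 1
  rw [← ENNReal.toReal_sum fun s' _ => PMF.apply_ne_top _ _, ← tsum_fintype (L := .unconditional S), PMF.tsum_coe,
    ENNReal.toReal_one]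

variable [DecidableEq S]

/-- The vector `(1 - l Q)⁻¹ r` of the pure stationary strategy `σ`. -/
noncomputable def resolvent (M : MDP S A) (l : ℝ) (σ : PureStationary A) : S → ℝ :=
  (1 - l • M.transitionMatrix σ)⁻¹.mulVec (M.payoffVector σ)

theorem resolvent_eq (M : MDP S A) {l : ℝ} (hl : l ∈ Set.Ico (0 : ℝ) 1) (σ : PureStationary A)
    (s : S) : M.resolvent l σ s = M.r s (σ s) + l * M.next (M.resolvent l σ) ⟨s, σ s⟩ := by
  have hdet := (Matrix.isUnit_iff_isUnit_det _).1
    ((M.isRowStochastic_transitionMatrix σ).isUnit_one_sub hl)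
  have h : (1 - l • M.transitionMatrix σ).mulVec (M.resolvent l σ) = M.payoffVector σ := by
    rw [resolvent, Matrix.mulVec_mulVec, Matrix.mul_nonsing_inv _ hdet, Matrix.one_mulVec]
  have hs := congrFun h s
  rw [Matrix.sub_mulVec, Matrix.one_mulVec, Matrix.smul_mulVec] at hs
  exact sub_eq_iff_eq_add.1 hs

theorem payoff_toBehavior [∀ s, Finite (A s)] (M : MDP S A) {l : ℝ} (hl : l ∈ Set.Ico (0 : ℝ) 1)
    (μ : PMF S) (σ : PureStationary A) :
    M.payoff l μ σ.toBehavior = ∑ s, (μ s).toReal * M.resolvent l σ s :=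
  M.payoff_eq hl μ σ (M.resolvent_eq hl σ)

/-- A pure stationary strategy that maximizes the sum of the payoffs over all initial states
satisfies the Bellman inequality: switching to a profitable action at one state would raise the
payoff there without lowering it elsewhere. -/
theorem exists_resolvent_bellman [∀ s, Finite (A s)] [∀ s, Nonempty (A s)] (M : MDP S A) {l : ℝ}
    (hl : l ∈ Set.Ico (0 : ℝ) 1) : ∃ σ : PureStationary A, ∀ x : SA A,
      M.r x.1 x.2 + l * M.next (M.resolvent l σ) x ≤ M.resolvent l σ x.1 := by
  obtain ⟨σ, hσ⟩ := Finite.exists_max fun σ : PureStationary A => ∑ s, M.resolvent l σ s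
  refine ⟨σ, fun ⟨t, a⟩ => ?_⟩
  by_contra! hlt
  change M.resolvent l σ t < M.r t a + l * M.next (M.resolvent l σ) ⟨t, a⟩ at hlt
  set v := M.resolvent l σ
  let τ : PureStationary A := Function.update σ t a
  set v' := M.resolvent l τ
  have hτ : τ t = a := Function.update_self t a σ
  have hdiff : ∀ s, l * ∑ j, M.transitionMatrix τ s j * (v' j - v j) =
      v' s - (M.r s (τ s) + l * M.next v ⟨s, τ s⟩) := fun s => by
    have h1 : ∑ j, M.transitionMatrix τ s j * (v' j - v j) =
        M.next v' ⟨s, τ s⟩ - M.next v ⟨s, τ s⟩ := by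
      simp only [mul_sub, Finset.sum_sub_distrib]
      rfl
    have h2 : v' s = M.r s (τ s) + l * M.next v' ⟨s, τ s⟩ := M.resolvent_eq hl τ s
    rw [h1, h2]
    ring
  have himp : ∀ s, v s ≤ M.r s (τ s) + l * M.next v ⟨s, τ s⟩ := fun s => by
    by_cases h : s = t
    · subst h
      rw [hτ]
      exact hlt.le
    · have h2 : τ s = σ s := Function.update_of_ne h a σ
      rw [h2]
      exact (M.resolvent_eq hl σ s).le
  have hnonneg : ∀ s, 0 ≤ v' s - v s :=
    (M.isRowStochastic_transitionMatrix τ).nonneg_of_le hl fun s => by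
      rw [hdiff]
      linarith [himp s]
  have hpos : v t < v' t := by
    have h1 : 0 ≤ l * ∑ j, M.transitionMatrix τ t j * (v' j - v j) :=
      mul_nonneg hl.1 (Finset.sum_nonneg fun j _ =>
        mul_nonneg ((M.isRowStochastic_transitionMatrix τ).1 t j) (hnonneg j))
    rw [hdiff, hτ] at h1
    linarith
  exact (hσ τ).not_gt (Finset.sum_lt_sum (fun s _ => sub_nonneg.1 (hnonneg s))
    ⟨t, Finset.mem_univ t, hpos⟩)

theorem exists_coprime_payoff [∀ s, Finite (A s)] (M : MDP S A) (σ : PureStationary A)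
    (μ : PMF S) : ∃ P D : ℝ[X], IsCoprime P D ∧ D ∣ (M.transitionMatrix σ).charpolyRev ∧
      AdmissibleDenominator D ∧
      ∀ l ∈ Set.Ico (0 : ℝ) 1, M.payoff l μ σ.toBehavior = P.eval l / D.eval l := by
  obtain ⟨P, D, hPD, hdvd, hD, h⟩ :=
    (M.isRowStochastic_transitionMatrix σ).exists_coprime_fraction (fun s => (μ s).toReal)
      (M.payoffVector σ)
  exact ⟨P, D, hPD, hdvd, hD, fun l hl => (M.payoff_toBehavior hl μ σ).trans (h l hl)⟩

/-- For each discount factor, the value is the maximum of the payoffs of the pure stationary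
strategies. -/
theorem isGreatest_value [∀ s, Finite (A s)] [∀ s, Nonempty (A s)] (M : MDP S A) {l : ℝ}
    (hl : l ∈ Set.Ico (0 : ℝ) 1) (μ : PMF S) :
    IsGreatest (Set.range fun σ : PureStationary A => M.payoff l μ σ.toBehavior)
      (M.value l μ) := by
  have hle : ∀ σ : PureStationary A, M.payoff l μ σ.toBehavior ≤ M.value l μ := fun σ =>
    le_ciSup (M.bddAbove_payoff hl μ) σ.toBehavior
  obtain ⟨σ, hσ⟩ := M.exists_resolvent_bellman hl
  have : Nonempty (BehaviorStrategy A) := ⟨σ.toBehavior⟩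
  refine ⟨⟨σ, (hle σ).antisymm (ciSup_le fun β => ?_)⟩, ?_⟩
  · exact (M.payoff_le hl μ β hσ).trans (M.payoff_toBehavior hl μ σ).ge
  · rintro _ ⟨τ, rfl⟩
    exact hle τ

end MDP

theorem valueFunctions_subset_MaxF : valueFunctions.{u, v} ⊆ MaxF := by
  classical
  rintro w ⟨S, A, hS, _, _, M, μ, hw⟩
  have := Fintype.ofFinite S
  refine ⟨Set.range fun (σ : MDP.PureStationary A) (l : Set.Ico (0 : ℝ) 1) =>
    M.payoff (l : ℝ) μ σ.toBehavior, Set.finite_range _, ?_, fun l => ?_⟩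
  · rintro _ ⟨σ, rfl⟩
    obtain ⟨P, D, -, -, hD, h⟩ := M.exists_coprime_payoff σ μ
    exact ⟨P, D, hD, fun l => h l l.2⟩
  · rw [hw l, ← Set.range_comp]
    exact M.isGreatest_value l.2 μ

theorem proposition1 :
    -- every value function is a finite maximum of functions in `𝓕`
    valueFunctions.{u, v} ⊆ MaxF ∧
    -- for every pure stationary strategy `σ`, with transition matrix `Q` and stage payoffs `r`:
    ∀ (S : Type u) (A : S → Type v) [Fintype S] [DecidableEq S] [∀ s, Finite (A s)]
      (M : MDP S A) (σ : MDP.PureStationary A),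
      -- the payoff is `(1 - l Q)⁻¹ r`
      (∀ l ∈ Set.Ico (0 : ℝ) 1, IsUnit (1 - l • M.transitionMatrix σ) ∧
        ∀ s, M.payoff l (PMF.pure s) σ.toBehavior =
          ((1 - l • M.transitionMatrix σ)⁻¹.mulVec (M.payoffVector σ)) s) ∧
      -- `det (1 - X Q)` has no root in the open unit ball; its roots on the circle are unit roots
      (∀ z : ℂ, ((M.transitionMatrix σ).charpolyRev.map (algebraMap ℝ ℂ)).IsRoot z →
        1 < ‖z‖ ∨ ∃ n : ℕ, 0 < n ∧ z ^ n = 1) ∧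
      -- for every prior, the payoff is a rational function in lowest terms whose denominator
      -- divides `det (1 - X Q)` and has only simple roots on the unit circle
      ∀ μ : PMF S, ∃ P D : ℝ[X], IsCoprime P D ∧ D ∣ (M.transitionMatrix σ).charpolyRev ∧
        AdmissibleDenominator D ∧
        ∀ l ∈ Set.Ico (0 : ℝ) 1, M.payoff l μ σ.toBehavior = P.eval l / D.eval l := by
  refine ⟨valueFunctions_subset_MaxF, fun S A _ _ _ M σ => ⟨fun l hl => ⟨?_, fun s => ?_⟩,
    fun z hz => ?_, fun μ => M.exists_coprime_payoff σ μ⟩⟩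
  · exact (M.isRowStochastic_transitionMatrix σ).isUnit_one_sub hl
  · rw [M.payoff_toBehavior hl, Finset.sum_eq_single s]
    · simp [MDP.resolvent]
    · intro t _ ht
      simp [PMF.pure_apply, ht]
    · simp
  · rw [IsRoot, eval_map_algebraMap] at hz
    exact (M.isRowStochastic_transitionMatrix σ).root_charpolyRev hz
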